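/- **Theorem.** Fix a countably infinite set of propositional variables. Consider the modal language whose formulas are built from the propositional variables by Boolean connectives, the graded forward modalities $\Diamond_{\geq n}$ for all $n\in\mathbb N$, and the basic (ungraded) converse modality $\Diamond^{-}$. Formulas are interpreted in Kripke structures $\mathfrak A=\langle W,R,V\rangle$, where $W$ is a nonempty (possibly infinite) set of worlds, $R\subseteq W\times W$, and $V$ assigns a subset of $W$ to each variable: variables and Boolean connectives are interpreted as usual; $\mathfrak A,w\models\Diamond_{\geq n}\varphi$ iff there are at least $n$ worlds $v$ with $\langle w,v\rangle\in R$ and $\mathfrak A,v\models\varphi$; and $\mathfrak A,w\models\Diamond^{-}\varphi$ iff there is a world $v$ with $\langle v,w\rangle\in R$ and $\mathfrak A,v\models\varphi$. For a class $\mathcal F$ of frames $\langle W,R\rangle$, a formula is *locally* (respectively *globally*) *satisfiable over $\mathcal F$* if it is true at some world (respectively at all worlds) of some structure whose frame belongs to $\mathcal F$. Let $\mathcal F$ be any one of the following classes: all transitive frames (K4), all serial transitive frames (D4), all reflexive transitive frames (S4); here $R$ is serial if every world has an $R$-successor. Then: 1. every formula that is locally satisfiable over $\mathcal F$ is true at some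 world of a structure with finitely many worlds whose frame belongs to $\mathcal F$; 2. every formula that is globally satisfiable over $\mathcal F$ is true at all worlds of a structure with finitely many worlds whose frame belongs to $\mathcal F$; 3. the problem of deciding whether a given formula is locally satisfiable over $\mathcal F$ is decidable; 4. the problem of deciding whether a given formula is globally satisfiable over $\mathcal F$ is decidable. -/

import Mathlib

universe u

namespace GradedModal

/-- Formulas of the modal language with graded forward modalities `◇_{≥ n}` and the basic converse
modality `◇⁻`. The propositional variables are indexed by `ℕ`; negation and conjunction are the
primitive Boolean connectives, the other ones being abbreviations as usual. -/
inductive Formula : Type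
  | var (p : ℕ) : Formula
  | neg (φ : Formula) : Formula
  | and (φ ψ : Formula) : Formula
  | dia (n : ℕ) (φ : Formula) : Formula
  | cdia (φ : Formula) : Formula

namespace Formula

/-- The Gödel number of a formula. -/
def toNat : Formula → ℕ
  | var p => 5 * p
  | neg φ => 5 * toNat φ + 1
  | and φ ψ => 5 * Nat.pair (toNat φ) (toNat ψ) + 2
  | dia n φ => 5 * Nat.pair n (toNat φ) + 3
  | cdia φ => 5 * toNat φ + 4

/-- The formula with a given Gödel number. -/
def ofNat (m : ℕ) : Formula :=
  if m % 5 = 0 then var (m / 5)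
  else if m % 5 = 1 then neg (ofNat (m / 5))
  else if m % 5 = 2 then and (ofNat (m / 5).unpair.1) (ofNat (m / 5).unpair.2)
  else if m % 5 = 3 then dia (m / 5).unpair.1 (ofNat (m / 5).unpair.2)
  else cdia (ofNat (m / 5))
termination_by m
decreasing_by
  all_goals
    have h1 := Nat.unpair_left_le (m / 5)
    have h2 := Nat.unpair_right_le (m / 5)
    omega

theorem ofNat_toNat (φ : Formula) : ofNat (toNat φ) = φ := by
  induction φ with
  | var p =>
    have h : 5 * p / 5 = p := by omega
    rw [toNat, ofNat]; simp
  | neg φ ih =>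
    have h : (5 * toNat φ + 1) / 5 = toNat φ := by omega
    rw [toNat, ofNat]; simp [Nat.add_mod, h, ih]
  | and φ ψ ih₁ ih₂ =>
    have h : (5 * Nat.pair (toNat φ) (toNat ψ) + 2) / 5 = Nat.pair (toNat φ) (toNat ψ) := by omega
    rw [toNat, ofNat]; simp [Nat.add_mod, h, ih₁, ih₂]
  | dia n φ ih =>
    have h : (5 * Nat.pair n (toNat φ) + 3) / 5 = Nat.pair n (toNat φ) := by omega
    rw [toNat, ofNat]; simp [Nat.add_mod, h, ih]
  | cdia φ ih =>
    have h : (5 * toNat φ + 4) / 5 = toNat φ := by omega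
    rw [toNat, ofNat]; simp [Nat.add_mod, h, ih]

theorem toNat_ofNat (m : ℕ) : toNat (ofNat m) = m := by
  induction m using Nat.strong_induction_on with
  | _ m ih =>
    have h1 := Nat.unpair_left_le (m / 5)
    have h2 := Nat.unpair_right_le (m / 5)
    rw [ofNat]
    split_ifs with c0 c1 c2 c3
    · rw [toNat]; omega
    · rw [toNat, ih _ (by omega)]; omega
    · rw [toNat, ih _ (by omega), ih _ (by omega), Nat.pair_unpair]; omega
    · rw [toNat, ih _ (by omega), Nat.pair_unpair]; omega
    · rw [toNat, ih _ (by omega)]; omega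

/-- Formulas are effectively coded by natural numbers (`Encodable.encode` is `toNat`), so that
Mathlib's `ComputablePred` makes sense for sets of formulas. -/
instance : Denumerable Formula :=
  Denumerable.mk' ⟨toNat, ofNat, ofNat_toNat, toNat_ofNat⟩

end Formula

/-- A Kripke frame: a nonempty set of worlds with a binary accessibility relation. -/
structure Frame : Type (u + 1) where
  World : Type u
  nonempty : Nonempty World
  R : World → World → Prop

/-- A Kripke structure: a frame with a valuation. -/
structure Model : Type (u + 1) extends Frame.{u} where
  V : ℕ → Set World

/-- The satisfaction relation `M, w ⊨ φ`; `◇_{≥ n} φ` says that the set of successors satisfying `φ`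
has (possibly infinite) cardinality at least `n`. -/
def Sat (M : Model.{u}) : M.World → Formula → Prop
  | w, .var p => w ∈ M.V p
  | w, .neg φ => ¬ Sat M w φ
  | w, .and φ ψ => Sat M w φ ∧ Sat M w ψ
  | w, .dia n φ => (n : ℕ∞) ≤ Set.encard {v : M.World | M.R w v ∧ Sat M v φ}
  | w, .cdia φ => ∃ v : M.World, M.R v w ∧ Sat M v φ

/-- A class of frames. -/
abbrev FrameClass : Type (u + 1) := Set Frame.{u}

/-- Transitive frames. -/
def K4 : FrameClass.{u} :=
  {F | ∀ x y z : F.World, F.R x y → F.R y z → F.R x z}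

/-- Serial transitive frames. -/
def D4 : FrameClass.{u} :=
  {F | (∀ x : F.World, ∃ y, F.R x y) ∧ ∀ x y z : F.World, F.R x y → F.R y z → F.R x z}

/-- Reflexive transitive frames. -/
def S4 : FrameClass.{u} :=
  {F | (∀ x : F.World, F.R x x) ∧ ∀ x y z : F.World, F.R x y → F.R y z → F.R x z}

/-- `φ` is true at some world of some structure whose frame belongs to `C`. -/
def LocallySatisfiable (C : FrameClass.{u}) (φ : Formula) : Prop :=
  ∃ M : Model.{u}, M.toFrame ∈ C ∧ ∃ w : M.World, Sat M w φ

/-- `φ` is true at all worlds of some structure whose frame belongs to `C`. -/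
def GloballySatisfiable (C : FrameClass.{u}) (φ : Formula) : Prop :=
  ∃ M : Model.{u}, M.toFrame ∈ C ∧ ∀ w : M.World, Sat M w φ

/-- The frames of `C` with finitely many worlds. -/
def finiteFrames (C : FrameClass.{u}) : FrameClass.{u} :=
  {F | F ∈ C ∧ Finite F.World}

/-- The finite local model property of the logic of `C`. -/
def FiniteLocalModelProperty (C : FrameClass.{u}) : Prop :=
  ∀ φ : Formula, LocallySatisfiable C φ → LocallySatisfiable (finiteFrames C) φ

/-- The finite global model property of the logic of `C`. -/
def FiniteGlobalModelProperty (C : FrameClass.{u}) : Prop :=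
  ∀ φ : Formula, GloballySatisfiable C φ → GloballySatisfiable (finiteFrames C) φ

end GradedModal

namespace GradedModal

/-! ### Auxiliary counting of finite sets and unions -/

open Set Relation

/-! A transitive model is compressed to a finite one whose size is computably bounded in the Gödel
number of the formula. Colour each world by its theory on the formulas of number below `m`, and
count successors of each colour only up to `K = m`; this suffices, because a grade `n` occurring in
such a formula is smaller than `m`. A colour is rare at `w` if fewer than `K` successors of `w` have
it. Frequent colours leave freedom, whereas the rare successors must be reproduced exactly, together
with their own rare successors, and so on.

Two facts make this possible. By transitivity the truncated counts `fwd` can only shrink along the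
relation, and where they stay constant a rare successor of a rare successor is again a rare
successor of the starting point; hence the set of hereditarily rare successors has bounded size
(`encard_heredRefl_le`). Consequently the labelled isomorphism types of a world with this set,
labels being taken from a fixed `Fin N`, form a finite set. These `code`s are the new worlds.

The new relation (`Compressed.Rel`) asks that forward counts decrease, that predecessor colours
increase, and that whatever is rare for the source in the hereditary set of the target (or is the
target itself) already belongs to the hereditary set of the source, as the very same code. It is
transitive by construction. Rare colours then keep their exact number of successors
(`encard_succs_rare`), frequent ones keep at least `K` since there are enough labels to keep the
copies apart (`le_encard_succs`), and the predecessor colours are unchanged (`bwd_rel_eq`). Truth is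
therefore preserved at every world (`sat_compress`), and so are seriality and reflexivity, which
gives both finite model properties. Decidability follows by searching through all structures up to
the explicit size bound, which is a primitive recursive search. -/

/-- A partial injection into a large enough finite type extends to a larger finite set. -/
theorem exists_injOn_extension {W : Type*} {N : ℕ} (i : W → Fin N) {X Y : Set W}
    (hY : InjOn i Y) (hX : X.Finite) (hN : (Y ∪ X).encard ≤ N) :
    ∃ j : W → Fin N, InjOn j (Y ∪ X) ∧ EqOn j i Y := by
  induction X, hX using Set.Finite.induction_on with
  | empty => exact ⟨i, by simpa using hY, fun _ _ => rfl⟩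
  | @insert z Z hz hZ ih =>
    have hsub : Y ∪ Z ⊆ Y ∪ insert z Z := union_subset_union_right _ (subset_insert _ _)
    obtain ⟨j, hj, hji⟩ := ih ((encard_le_encard hsub).trans hN)
    by_cases hzY : z ∈ Y ∪ Z
    · rw [union_insert, insert_eq_of_mem hzY]
      exact ⟨j, hj, hji⟩
    · rw [union_insert] at hN ⊢
      rw [encard_insert_of_notMem hzY] at hN
      have hne : ∃ k, k ∉ j '' (Y ∪ Z) := by
        by_contra! hall
        have h1 : j '' (Y ∪ Z) = univ := eq_univ_of_forall hall
        have h2 := hj.encard_image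
        rw [h1, encard_univ, ENat.card_eq_coe_fintype_card, Fintype.card_fin] at h2
        rw [← h2] at hN
        exact absurd hN (by exact_mod_cast Nat.not_succ_le_self N)
      obtain ⟨k, hk⟩ := hne
      classical
      have hup : ∀ x ∈ Y ∪ Z, Function.update j z k x = j x := fun x hx =>
        Function.update_of_ne (by rintro rfl; exact hzY hx) _ _
      refine ⟨Function.update j z k, (injOn_insert hzY).2 ⟨?_, ?_⟩, fun x hx => ?_⟩
      · exact hj.congr fun x hx => (hup x hx).symm
      · rw [Function.update_self, image_congr hup]
        exact hk
      · rw [hup x (Or.inl hx), hji hx]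

theorem encard_biUnion_le_mul {α β : Type*} {V : Set α} {S : α → Set β} {k h : ℕ}
    (hV : V.encard ≤ k) (hS : ∀ v ∈ V, (S v).encard ≤ h) :
    (⋃ v ∈ V, S v).encard ≤ (k * h : ℕ) := by
  have hfin := finite_of_encard_le_coe hV
  have key : (⋃ v ∈ V, S v).encard ≤ V.encard * h := by
    clear hV
    induction V, hfin using Set.Finite.induction_on with
    | empty => simp
    | @insert a s ha hs ih =>
      rw [biUnion_insert, encard_insert_of_notMem ha, add_mul, one_mul, add_comm]
      exact (encard_union_le _ _).trans
        (add_le_add (hS a (mem_insert _ _)) (ih fun v hv => hS v (mem_insert_of_mem _ hv)))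
  refine key.trans ?_
  push_cast
  gcongr

/-! ### Rare colours and hereditarily rare successors -/

section Coloring

variable {W T : Type*} (R : W → W → Prop) (tp : W → T) (K : ℕ)

/-- The successors of a given colour. -/
def succs (w : W) (t : T) : Set W := {v | R w v ∧ tp v = t}

/-- The numbers of successors of each colour, counted up to the threshold `K`. -/
def fwd (w : W) : Set (T × Fin (K + 1)) := {p | ((p.2 : ℕ) : ℕ∞) ≤ (succs R tp w p.1).encard}

/-- The colours of the predecessors. -/
def bwd (w : W) : Set T := {t | ∃ u, R u w ∧ tp u = t}

/-- The colour `t` has fewer than `K` occurrences among the successors of `w`. -/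
def RareAt (w : W) (t : T) : Prop := (t, Fin.last K) ∉ fwd R tp K w

/-- `v` is a successor of `w` of a rare colour. -/
def Rare (w v : W) : Prop := R w v ∧ RareAt R tp K w (tp v)

/-- The hereditarily rare successors. -/
def hered (w : W) : Set W := {v | TransGen (Rare R tp K) w v}

/-- A world together with its hereditarily rare successors. -/
def heredRefl (w : W) : Set W := {v | ReflTransGen (Rare R tp K) w v}

variable {R tp K}

theorem rareAt_iff {w : W} {t : T} : RareAt R tp K w t ↔ (succs R tp w t).encard < K := by
  simp [RareAt, fwd]

theorem mem_heredRefl {w v : W} : v ∈ heredRefl R tp K w ↔ v = w ∨ v ∈ hered R tp K w :=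
  reflTransGen_iff_eq_or_transGen

theorem self_mem_heredRefl (w : W) : w ∈ heredRefl R tp K w := ReflTransGen.refl

theorem hered_subset_heredRefl (w : W) : hered R tp K w ⊆ heredRefl R tp K w :=
  fun _ h => TransGen.to_reflTransGen h

theorem heredRefl_subset_hered {w v : W} (h : v ∈ hered R tp K w) :
    heredRefl R tp K v ⊆ hered R tp K w := fun _ hx => TransGen.trans_left h hx

theorem hered_subset_hered {w v : W} (h : v ∈ heredRefl R tp K w) :
    hered R tp K v ⊆ hered R tp K w := fun _ hx => TransGen.trans_right h hx

theorem heredRefl_subset_heredRefl {w v : W} (h : v ∈ heredRefl R tp K w) :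
    heredRefl R tp K v ⊆ heredRefl R tp K w := fun _ hx => ReflTransGen.trans h hx

theorem Rare.mem_hered {w v : W} (h : Rare R tp K w v) : v ∈ hered R tp K w := TransGen.single h

theorem encard_rare_le [Fintype T] (w : W) :
    {v | Rare R tp K w v}.encard ≤ (Fintype.card T * K : ℕ) := by
  have h1 : {v | Rare R tp K w v} ⊆ ⋃ t ∈ {t | RareAt R tp K w t}, succs R tp w t := by
    intro v hv
    simp only [mem_iUnion]
    exact ⟨tp v, hv.2, hv.1, rfl⟩
  refine (encard_le_encard h1).trans (encard_biUnion_le_mul ?_ fun t ht => (rareAt_iff.1 ht).le)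
  refine (encard_le_encard (subset_univ _)).trans ?_
  rw [encard_univ, ENat.card_eq_coe_fintype_card]

section Transitive

variable (hR : ∀ x y z, R x y → R y z → R x z)
include hR

theorem rel_of_mem_hered {w v : W} (h : v ∈ hered R tp K w) : R w v := by
  induction h with
  | single h => exact h.1
  | tail _ h ih => exact hR _ _ _ ih h.1

theorem succs_subset {w v : W} (h : R w v) (t : T) : succs R tp v t ⊆ succs R tp w t :=
  fun _ hx => ⟨hR _ _ _ h hx.1, hx.2⟩

/-- By transitivity, successors of `v` are successors of `w`. So a colour rare at `w` remains rare
at `v`, and the size of `fwd` can serve as an induction measure along the relation. -/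
theorem fwd_subset {w v : W} (h : R w v) : fwd R tp K v ⊆ fwd R tp K w :=
  fun _ hp => le_trans hp (encard_le_encard (succs_subset hR h _))

theorem insert_bwd_subset {w v : W} (h : R w v) :
    insert (tp w) (bwd R tp w) ⊆ bwd R tp v := by
  rintro t (rfl | ⟨u, hu, rfl⟩)
  · exact ⟨w, h, rfl⟩
  · exact ⟨u, hR _ _ _ hu h, rfl⟩

theorem rel_of_rel_of_mem_heredRefl {w v x : W} (h : R w v) (hx : x ∈ heredRefl R tp K v) :
    R w x := by
  rcases mem_heredRefl.1 hx with rfl | hx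
  · exact h
  · exact hR _ _ _ h (rel_of_mem_hered hR hx)

/-- Induction on the size of `fwd`, with at most `r` rare successors `v` of `w`. If `fwd` drops at
`v`, the induction hypothesis bounds what lies above `v`. If it does not drop, `v` and `w` have the
same rare colours, so the rare successors of `v` are rare successors of `w`, and only `v` itself has
to be counted. -/
theorem encard_heredRefl_le_pow_ncard [Fintype T] (w : W) :
    (heredRefl R tp K w).encard ≤
      ((Fintype.card T * K + 1) ^ ((fwd R tp K w).ncard + 1) : ℕ) := by
  induction hs : (fwd R tp K w).ncard using Nat.strong_induction_on generalizing w with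
  | _ s ih =>
    set r := Fintype.card T * K
    classical
    let S : W → Set W := fun v =>
      if (fwd R tp K v).ncard < s then heredRefl R tp K v else {v}
    have hself : ∀ v, v ∈ S v := fun v => by
      by_cases h : (fwd R tp K v).ncard < s
      · simp only [S, if_pos h]; exact self_mem_heredRefl v
      · simp [S, if_neg h]
    have hsub : heredRefl R tp K w ⊆ {w} ∪ ⋃ v ∈ {v | Rare R tp K w v}, S v := by
      intro x hx
      induction hx with
      | refl => exact Or.inl rfl
      | @tail y z _ hyz ih' =>
        right
        simp only [mem_iUnion]
        rcases ih' with rfl | hy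
        · exact ⟨z, hyz, hself z⟩
        · simp only [mem_iUnion] at hy
          obtain ⟨v, hv, hy⟩ := hy
          by_cases h : (fwd R tp K v).ncard < s
          · refine ⟨v, hv, ?_⟩
            simp only [S, if_pos h] at hy ⊢
            exact ReflTransGen.tail hy hyz
          · simp only [S, if_neg h, mem_singleton_iff] at hy
            subst hy
            -- No drop: inclusion together with cardinality forces equality, so rarity at `y` is
            -- rarity at `w`, and the path through `y` is replaced by a direct rare edge from `w`.
            have hf : fwd R tp K y = fwd R tp K w :=
              Set.eq_of_subset_of_ncard_le (fwd_subset hR hv.1) (by omega)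
            refine ⟨z, ⟨hR _ _ _ hv.1 hyz.1, ?_⟩, hself z⟩
            have := hyz.2
            rwa [RareAt, hf] at this
    have hS : ∀ v ∈ {v | Rare R tp K w v}, (S v).encard ≤ ((r + 1) ^ s : ℕ) := by
      intro v _
      by_cases h : (fwd R tp K v).ncard < s
      · simp only [S, if_pos h]
        refine (ih _ h v rfl).trans ?_
        exact_mod_cast Nat.pow_le_pow_right (by omega) h
      · simp only [S, if_neg h, encard_singleton]
        exact_mod_cast Nat.one_le_pow _ _ (by omega)
    refine (encard_le_encard hsub).trans ((encard_union_le _ _).trans ?_)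
    refine (add_le_add (encard_singleton w).le
      (encard_biUnion_le_mul (encard_rare_le w) hS)).trans ?_
    have : 1 + r * (r + 1) ^ s ≤ (r + 1) ^ (s + 1) := by
      have := Nat.one_le_pow s (r + 1) (by omega)
      rw [pow_succ]; nlinarith
    exact_mod_cast this

/-- A bound for the number of hereditarily rare successors, for `t` colours. -/
def heredBound (t K : ℕ) : ℕ := (t * K + 1) ^ (t * (K + 1) + 1)

theorem encard_heredRefl_le [Fintype T] (w : W) :
    (heredRefl R tp K w).encard ≤ heredBound (Fintype.card T) K := by
  refine (encard_heredRefl_le_pow_ncard hR w).trans ?_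
  have : (fwd R tp K w).ncard ≤ Fintype.card T * (K + 1) := by
    refine (ncard_le_ncard (subset_univ _)).trans ?_
    rw [ncard_univ, Nat.card_eq_fintype_card, Fintype.card_prod, Fintype.card_fin]
  exact_mod_cast Nat.pow_le_pow_right (by omega) (by omega)

end Transitive

end Coloring

/-! ### Labelled isomorphism types -/

section Code

variable {W T : Type*} (R : W → W → Prop) (tp : W → T) (K N : ℕ)

/-- The colour of a world together with its counts of successors and its kinds of predecessors. -/
abbrev Profile (T : Type*) (K : ℕ) : Type _ := T × Set (T × Fin (K + 1)) × Set T

/-- The profile of a world. -/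
def profile (w : W) : Profile T K := (tp w, fwd R tp K w, bwd R tp w)

/-- Isomorphism types of worlds with their hereditarily rare successors, on subsets of `Fin N`. -/
abbrev Code (T : Type*) (K N : ℕ) : Type _ := Fin N × Set (Fin N × Profile T K × Set (Fin N))

/-- The isomorphism type of `w` with its hereditarily rare successors labelled by `i`. -/
def code (i : W → Fin N) (w : W) : Code T K N :=
  (i w, (fun x => (i x, profile R tp K x, i '' hered R tp K x)) '' heredRefl R tp K w)

variable {R tp K N}

theorem code_congr {i j : W → Fin N} {w : W} (h : EqOn i j (heredRefl R tp K w)) :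
    code R tp K N i w = code R tp K N j w := by
  refine Prod.ext (h (self_mem_heredRefl w)) (image_congr fun x hx => ?_)
  have h1 : i '' hered R tp K x = j '' hered R tp K x := image_congr fun y hy =>
    h (hered_subset_heredRefl w (hered_subset_hered hx hy))
  simp only [h hx, h1]

theorem exists_eq_of_code_eq {i j : W → Fin N} {w w' x : W}
    (h : code R tp K N i w = code R tp K N j w') (hx : x ∈ heredRefl R tp K w) :
    ∃ y ∈ heredRefl R tp K w', j y = i x ∧ profile R tp K y = profile R tp K x ∧
      j '' hered R tp K y = i '' hered R tp K x := by
  have h1 : (i x, profile R tp K x, i '' hered R tp K x) ∈ (code R tp K N j w').2 :=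
    h ▸ ⟨x, hx, rfl⟩
  obtain ⟨y, hy, hyx⟩ := h1
  simp only [Prod.mk.injEq] at hyx
  exact ⟨y, hy, hyx.1, hyx.2.1, hyx.2.2⟩

theorem eq_root_of_code_eq {i j : W → Fin N} {w w' : W}
    (hj : InjOn j (heredRefl R tp K w')) (h : code R tp K N i w = code R tp K N j w') :
    profile R tp K w' = profile R tp K w ∧ j '' hered R tp K w' = i '' hered R tp K w := by
  obtain ⟨y, hy, h1, h2, h3⟩ := exists_eq_of_code_eq h (self_mem_heredRefl w)
  have h0 : i w = j w' := congrArg Prod.fst h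
  obtain rfl : y = w' := hj hy (self_mem_heredRefl w') (h1.trans h0)
  exact ⟨h2, h3⟩

theorem image_heredRefl_eq {i j : W → Fin N} {v v' : W} (h0 : j v' = i v)
    (h : j '' hered R tp K v' = i '' hered R tp K v) :
    j '' heredRefl R tp K v' = i '' heredRefl R tp K v := by
  have : ∀ z : W, heredRefl R tp K z = insert z (hered R tp K z) := fun z =>
    Set.ext fun _ => mem_heredRefl
  rw [this, this, image_insert_eq, image_insert_eq, h0, h]

/-- Equal codes match elements by label, with equal profiles and equal label sets of `hered`.
Injectivity of the labelling identifies the match with the element carrying that label inside the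
smaller set, so it is enough to compare label sets. -/
theorem code_subset_of_code_eq {i j : W → Fin N} {w w' v v' : W}
    (hj : InjOn j (heredRefl R tp K w')) (h : code R tp K N i w = code R tp K N j w')
    (hv : v ∈ heredRefl R tp K w) (hv' : v' ∈ heredRefl R tp K w')
    (himg : j '' heredRefl R tp K v' = i '' heredRefl R tp K v) :
    (code R tp K N i v).2 ⊆ (code R tp K N j v').2 := by
  rintro _ ⟨x, hx, rfl⟩
  obtain ⟨y, hy, h1, h2, h3⟩ := exists_eq_of_code_eq h (heredRefl_subset_heredRefl hv hx)
  have : i x ∈ j '' heredRefl R tp K v' := himg ▸ ⟨x, hx, rfl⟩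
  obtain ⟨z, hz, hzx⟩ := this
  obtain rfl : y = z := hj hy (heredRefl_subset_heredRefl hv' hz) (h1.trans hzx.symm)
  exact ⟨y, hz, by simp only [h1, h2, h3]⟩

/-- A code determines the codes of all hereditarily rare successors, because it records the label
set of `hered` at each of its elements. -/
theorem exists_mem_hered_of_code_eq {i j : W → Fin N} {w w' v : W}
    (hi : InjOn i (heredRefl R tp K w)) (hj : InjOn j (heredRefl R tp K w'))
    (h : code R tp K N i w = code R tp K N j w') (hv : v ∈ hered R tp K w) :
    ∃ v' ∈ hered R tp K w', code R tp K N j v' = code R tp K N i v := by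
  have h1 : i v ∈ j '' hered R tp K w' := (eq_root_of_code_eq hj h).2 ▸ ⟨v, hv, rfl⟩
  obtain ⟨v', hv', hvv⟩ := h1
  have hvr := hered_subset_heredRefl w hv
  have hvr' := hered_subset_heredRefl w' hv'
  obtain ⟨y, hy, e1, -, e3⟩ := exists_eq_of_code_eq h hvr
  obtain rfl : y = v' := hj hy hvr' (e1.trans hvv.symm)
  have himg := image_heredRefl_eq hvv e3
  refine ⟨y, hv', Prod.ext hvv (Subset.antisymm ?_ ?_)⟩
  · exact code_subset_of_code_eq hi h.symm hvr' hvr himg.symm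
  · exact code_subset_of_code_eq hj h hvr hvr' himg

variable (R tp K N) in
/-- A world with an injective labelling of its hereditarily rare successors. -/
structure Labelled where
  /-- the world -/
  world : W
  /-- the labelling -/
  label : W → Fin N
  injOn : InjOn label (heredRefl R tp K world)

/-- The code of a labelled world. -/
def Labelled.code (a : Labelled R tp K N) : Code T K N := GradedModal.code R tp K N a.label a.world

/-- The restriction of a labelling to a hereditarily rare successor. -/
def Labelled.restrict (a : Labelled R tp K N) (v : W) (hv : v ∈ heredRefl R tp K a.world) :
    Labelled R tp K N :=
  ⟨v, a.label, a.injOn.mono (heredRefl_subset_heredRefl hv)⟩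

variable (R tp K N) in
/-- The worlds of the finite frame. -/
def Compressed : Type _ := Set.range (Labelled.code : Labelled R tp K N → Code T K N)

/-- The point of the finite frame given by a labelled world. -/
def Labelled.pt (a : Labelled R tp K N) : Compressed R tp K N := ⟨a.code, a, rfl⟩

/-! ### The finite frame of codes -/

namespace Compressed

/-- A labelled world representing a point of the finite frame. -/
noncomputable def rep (c : Compressed R tp K N) : Labelled R tp K N := c.2.choose

theorem pt_rep (c : Compressed R tp K N) : c.rep.pt = c := Subtype.ext c.2.choose_spec

theorem profile_rep_pt (a : Labelled R tp K N) :
    profile R tp K a.pt.rep.world = profile R tp K a.world :=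
  ((eq_root_of_code_eq a.pt.rep.injOn (congrArg Subtype.val (pt_rep a.pt)).symm).1)

theorem tp_rep_pt (a : Labelled R tp K N) : tp a.pt.rep.world = tp a.world :=
  congrArg Prod.fst (profile_rep_pt a)

theorem fwd_rep_pt (a : Labelled R tp K N) :
    fwd R tp K a.pt.rep.world = fwd R tp K a.world :=
  congrArg (fun p => p.2.1) (profile_rep_pt a)

theorem bwd_rep_pt (a : Labelled R tp K N) : bwd R tp a.pt.rep.world = bwd R tp a.world :=
  congrArg (fun p => p.2.2) (profile_rep_pt a)

/-- The hereditarily rare successors of a point of the finite frame. -/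
def members (c : Compressed R tp K N) : Set (Compressed R tp K N) :=
  {d | ∃ (v : W) (hv : v ∈ hered R tp K c.rep.world),
    d = (c.rep.restrict v (hered_subset_heredRefl _ hv)).pt}

/-- Independence of representatives: `members` is defined through a chosen representative, but any
labelled world with the same code yields the same set. -/
theorem mem_members_pt {a : Labelled R tp K N} {d : Compressed R tp K N} :
    d ∈ a.pt.members ↔ ∃ (v : W) (hv : v ∈ hered R tp K a.world),
      d = (a.restrict v (hered_subset_heredRefl _ hv)).pt := by
  have h : a.pt.rep.code = a.code := congrArg Subtype.val (pt_rep a.pt)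
  constructor
  · rintro ⟨v, hv, rfl⟩
    obtain ⟨v', hv', e⟩ := exists_mem_hered_of_code_eq a.pt.rep.injOn a.injOn h hv
    exact ⟨v', hv', Subtype.ext e.symm⟩
  · rintro ⟨v, hv, rfl⟩
    obtain ⟨v', hv', e⟩ := exists_mem_hered_of_code_eq a.injOn a.pt.rep.injOn h.symm hv
    exact ⟨v', hv', Subtype.ext e.symm⟩

/-- The accessibility relation of the finite frame. -/
def Rel (c d : Compressed R tp K N) : Prop :=
  fwd R tp K d.rep.world ⊆ fwd R tp K c.rep.world ∧
  insert (tp c.rep.world) (bwd R tp c.rep.world) ⊆ bwd R tp d.rep.world ∧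
  ∀ x ∈ insert d d.members, RareAt R tp K c.rep.world (tp x.rep.world) → x ∈ c.members

/-- The third clause of `Rel` quantifies over the members of the target as well as the target itself
exactly so that it composes: what is rare at `c` is rare at `d`, hence passes first into `d.members`
and then into `c.members`. -/
theorem rel_trans {c d e : Compressed R tp K N} (h1 : c.Rel d) (h2 : d.Rel e) : c.Rel e := by
  refine ⟨h2.1.trans h1.1, h1.2.1.trans ((subset_insert _ _).trans h2.2.1), fun x hx hr => ?_⟩
  exact h1.2.2 x (Or.inr (h2.2.2 x hx fun h => hr (h1.1 h))) hr

theorem mem_members_of_rel {c d : Compressed R tp K N} (h : c.Rel d)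
    (hr : RareAt R tp K c.rep.world (tp d.rep.world)) : d ∈ c.members :=
  h.2.2 d (Or.inl rfl) hr

section

variable (hR : ∀ x y z, R x y → R y z → R x z)
include hR

/-- Criterion for accessibility in terms of labelled worlds. -/
theorem rel_pt {a b : Labelled R tp K N} (h : R a.world b.world)
    (hab : ∀ x ∈ heredRefl R tp K b.world, Rare R tp K a.world x →
      EqOn b.label a.label (heredRefl R tp K x)) : a.pt.Rel b.pt := by
  rw [Rel, fwd_rep_pt, fwd_rep_pt, tp_rep_pt a, bwd_rep_pt, bwd_rep_pt]
  refine ⟨fwd_subset hR h, insert_bwd_subset hR h, fun x hx hr => ?_⟩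
  have hx' : ∃ (v : W) (hv : v ∈ heredRefl R tp K b.world), x = (b.restrict v hv).pt := by
    rcases hx with rfl | hx
    · exact ⟨b.world, self_mem_heredRefl _, rfl⟩
    · obtain ⟨v, hv, rfl⟩ := mem_members_pt.1 hx
      exact ⟨v, hered_subset_heredRefl _ hv, rfl⟩
  obtain ⟨v, hv, rfl⟩ := hx'
  rw [tp_rep_pt (b.restrict v hv), RareAt, fwd_rep_pt] at hr
  -- A member of `b` whose colour is rare at `a` is a rare successor of `a`; as the two labellings
  -- agree above it, both assign it the same code.
  have hrare : Rare R tp K a.world v := ⟨rel_of_rel_of_mem_heredRefl hR h hv, hr⟩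
  exact mem_members_pt.2 ⟨v, hrare.mem_hered, Subtype.ext (code_congr (hab v hv hrare))⟩

theorem rel_of_mem_members {a : Labelled R tp K N} {v : W} (hv : v ∈ hered R tp K a.world) :
    a.pt.Rel (a.restrict v (hered_subset_heredRefl _ hv)).pt :=
  rel_pt hR (rel_of_mem_hered hR hv) fun _ _ _ _ _ => rfl

theorem rel_refl (hrefl : ∀ x, R x x) (c : Compressed R tp K N) : c.Rel c := by
  rw [← pt_rep c]
  exact rel_pt hR (hrefl _) fun _ _ _ _ _ => rfl

/-- A point has rare successors exactly as many as its representative. -/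
theorem encard_succs_rare (a : Labelled R tp K N) {t : T} (ht : RareAt R tp K a.world t) :
    (succs Rel (fun c : Compressed R tp K N => tp c.rep.world) a.pt t).encard =
      (succs R tp a.world t).encard := by
  have hsub : ∀ v ∈ succs R tp a.world t, v ∈ hered R tp K a.world := fun v hv =>
    Rare.mem_hered ⟨hv.1, hv.2 ▸ ht⟩
  let g : W → Compressed R tp K N := fun v =>
    open Classical in
    if h : v ∈ heredRefl R tp K a.world then (a.restrict v h).pt else a.pt
  have hg : ∀ v (h : v ∈ heredRefl R tp K a.world), g v = (a.restrict v h).pt := fun v h =>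
    dif_pos h
  have himg : succs Rel (fun c : Compressed R tp K N => tp c.rep.world) a.pt t =
      g '' succs R tp a.world t := by
    ext d
    constructor
    · rintro ⟨hd, rfl⟩
      have hd' : d ∈ a.pt.members := mem_members_of_rel hd (by
        rw [RareAt, fwd_rep_pt]; exact ht)
      obtain ⟨v, hv, rfl⟩ := mem_members_pt.1 hd'
      refine ⟨v, ⟨rel_of_mem_hered hR hv, ?_⟩, hg v _⟩
      exact (tp_rep_pt (a.restrict v (hered_subset_heredRefl _ hv))).symm
    · rintro ⟨v, hv, rfl⟩
      rw [hg v (hered_subset_heredRefl _ (hsub v hv))]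
      exact ⟨rel_of_mem_members hR (hsub v hv), (tp_rep_pt _).trans hv.2⟩
  -- The first component of a code is the label of its root, and `a.label` separates the
  -- hereditarily rare successors of `a`.
  rw [himg, InjOn.encard_image]
  intro v hv v' hv' h
  have h1 := hered_subset_heredRefl _ (hsub v hv)
  have h2 := hered_subset_heredRefl _ (hsub v' hv')
  rw [hg v h1, hg v' h2] at h
  exact a.injOn h1 h2 (congrArg (fun c => c.1.1) h)

/-- Successors of a frequent colour occur at least `K` times. -/
theorem le_encard_succs [Fintype T]
    (hN : (K + 1) * heredBound (Fintype.card T) K ≤ N) (a : Labelled R tp K N) {t : T}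
    (ht : K ≤ (succs R tp a.world t).encard) :
    K ≤ (succs Rel (fun c : Compressed R tp K N => tp c.rep.world) a.pt t).encard := by
  obtain ⟨V, hV, hVK⟩ := exists_subset_encard_eq ht
  have hb := fun w : W => encard_heredRefl_le (tp := tp) (K := K) hR w
  have hVfin : V.Finite := finite_of_encard_le_coe hVK.le
  have hX : (⋃ v ∈ V, heredRefl R tp K v).Finite :=
    hVfin.biUnion fun v _ => finite_of_encard_le_coe (hb v)
  -- A common labelling: it keeps the labels on `hered` of `a`, as accessibility requires, and is
  -- injective across all `K` chosen successors, so that they give distinct points. One block for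
  -- `a` and `K` for the successors account for the factor `K + 1` in `hN`.
  obtain ⟨j, hj, hja⟩ := exists_injOn_extension (N := N) a.label
    (a.injOn.mono (hered_subset_heredRefl _)) hX (by
      refine (encard_union_le _ _).trans ((add_le_add
        ((encard_le_encard (hered_subset_heredRefl _)).trans (hb a.world))
        (encard_biUnion_le_mul hVK.le fun v _ => hb v)).trans ?_)
      rw [add_mul, one_mul, add_comm] at hN
      exact_mod_cast hN)
  have hsub : ∀ v ∈ V, heredRefl R tp K v ⊆
      hered R tp K a.world ∪ ⋃ v ∈ V, heredRefl R tp K v := fun v hv =>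
    (subset_biUnion_of_mem (u := fun v => heredRefl R tp K v) hv).trans subset_union_right
  let g : V → Compressed R tp K N := fun v => (⟨v, j, hj.mono (hsub v v.2)⟩ : Labelled R tp K N).pt
  have hg : Function.Injective g := fun v v' h =>
    Subtype.ext (hj (hsub v v.2 (self_mem_heredRefl _)) (hsub v' v'.2 (self_mem_heredRefl _))
      (congrArg (fun c => c.1.1) h))
  have hrange : range g ⊆
      succs Rel (fun c : Compressed R tp K N => tp c.rep.world) a.pt t := by
    rintro _ ⟨v, rfl⟩
    refine ⟨rel_pt hR (hV v.2).1 fun x _ hx y hy => hja ?_, (tp_rep_pt _).trans (hV v.2).2⟩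
    exact heredRefl_subset_hered hx.mem_hered hy
  refine le_trans ?_ (encard_le_encard hrange)
  rw [← image_univ, hg.encard_image, encard_univ, ← hVK]
  rfl

theorem le_encard_succs_iff [Fintype T]
    (hN : (K + 1) * heredBound (Fintype.card T) K ≤ N) (c : Compressed R tp K N) (t : T)
    {k : ℕ} (hk : k ≤ K) :
    k ≤ (succs Rel (fun c : Compressed R tp K N => tp c.rep.world) c t).encard ↔
      k ≤ (succs R tp c.rep.world t).encard := by
  by_cases ht : RareAt R tp K c.rep.world t
  · rw [← encard_succs_rare hR c.rep ht, pt_rep]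
  · rw [rareAt_iff, not_lt] at ht
    have h1 := le_encard_succs hR hN c.rep ht
    rw [pt_rep] at h1
    have hk' : (k : ℕ∞) ≤ K := by exact_mod_cast hk
    exact iff_of_true (hk'.trans h1) (hk'.trans ht)

/-- One inclusion is the second clause of `Rel`. For the other, a predecessor `u` of the
representative is labelled consistently with it on the overlap of their hereditary sets; that
overlap contains everything above a rare successor of `u` lying over the representative. -/
theorem bwd_rel_eq [Fintype T]
    (hN : heredBound (Fintype.card T) K ≤ N) (c : Compressed R tp K N) :
    bwd Rel (fun c : Compressed R tp K N => tp c.rep.world) c = bwd R tp c.rep.world := by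
  ext t
  constructor
  · rintro ⟨d, hd, rfl⟩
    exact hd.2.1 (mem_insert _ _)
  · rintro ⟨u, hu, rfl⟩
    have hb := (encard_heredRefl_le (tp := tp) (K := K) hR u).trans
      (by exact_mod_cast hN : _ ≤ (N : ℕ∞))
    have hun : heredRefl R tp K c.rep.world ∩ heredRefl R tp K u ∪ heredRefl R tp K u =
      heredRefl R tp K u := union_eq_right.2 inter_subset_right
    -- Only the part of the labelling of `c` inside `heredRefl` of `u` is kept, so the labels needed
    -- are those for `u` alone.
    obtain ⟨j, hj, hjc⟩ := exists_injOn_extension (N := N) c.rep.label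
      (c.rep.injOn.mono (inter_subset_left (t := heredRefl R tp K u)))
      (finite_of_encard_le_coe hb) (by rwa [hun])
    rw [hun] at hj
    let a : Labelled R tp K N := ⟨u, j, hj⟩
    refine ⟨a.pt, ?_, tp_rep_pt a⟩
    conv_rhs => rw [← pt_rep c]
    refine rel_pt hR hu fun x hx hrx y hy => (hjc ⟨?_, ?_⟩).symm
    · exact heredRefl_subset_heredRefl hx hy
    · exact hered_subset_heredRefl _ (heredRefl_subset_hered hrx.mem_hered hy)

theorem exists_labelled [Fintype T] (hN : heredBound (Fintype.card T) K ≤ N) (w : W) :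
    ∃ a : Labelled R tp K N, a.world = w := by
  have hb := (encard_heredRefl_le (tp := tp) (K := K) hR w).trans
      (by exact_mod_cast hN : _ ≤ (N : ℕ∞))
  have hpos : 0 < N := lt_of_lt_of_le (by unfold heredBound; positivity) hN
  obtain ⟨j, hj, -⟩ := exists_injOn_extension (fun _ : W => (⟨0, hpos⟩ : Fin N))
    (injOn_empty _) (finite_of_encard_le_coe hb) (by rwa [empty_union])
  rw [empty_union] at hj
  exact ⟨⟨w, j, hj⟩, rfl⟩

end

instance [Finite T] : Finite (Compressed R tp K N) :=
  inferInstanceAs (Finite (Set.range _))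

/-- The explicit size is what makes the later search for a model computable; it counts all codes,
realised or not. -/
theorem card_le [Fintype T] : Nat.card (Compressed R tp K N) ≤
    N * 2 ^ (N * (Fintype.card T * (2 ^ (Fintype.card T * (K + 1)) * 2 ^ Fintype.card T)
      * 2 ^ N)) := by
  classical
  refine (Nat.card_le_card_of_injective Subtype.val Subtype.val_injective :
    Nat.card (Compressed R tp K N) ≤ Nat.card (Code T K N)).trans (le_of_eq ?_)
  rw [Nat.card_eq_fintype_card]
  simp only [Code, Profile, Fintype.card_prod, Fintype.card_set, Fintype.card_fin, mul_assoc]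

end Compressed

end Code

/-! ### Truncated counts over sets of colours -/

/-- A sum can reach `k` with neither summand reaching `k` only if both are finite and below `k`;
their exact values are then visible under the threshold `K`. -/
theorem le_add_iff_of_le_iff {K : ℕ} {x x' y y' : ℕ∞}
    (hx : ∀ k ≤ K, (k : ℕ∞) ≤ x ↔ (k : ℕ∞) ≤ x') (hy : ∀ k ≤ K, (k : ℕ∞) ≤ y ↔ (k : ℕ∞) ≤ y')
    {k : ℕ} (hk : k ≤ K) : (k : ℕ∞) ≤ x + y ↔ (k : ℕ∞) ≤ x' + y' := by
  have key : ∀ {a a' b b' : ℕ∞}, (∀ k ≤ K, (k : ℕ∞) ≤ a → (k : ℕ∞) ≤ a') →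
      (∀ k ≤ K, (k : ℕ∞) ≤ b → (k : ℕ∞) ≤ b') → (k : ℕ∞) ≤ a + b → (k : ℕ∞) ≤ a' + b' := by
    intro a a' b b' ha hb hab
    by_cases h1 : (k : ℕ∞) ≤ a
    · exact (ha k hk h1).trans le_self_add
    by_cases h2 : (k : ℕ∞) ≤ b
    · exact (hb k hk h2).trans le_add_self
    obtain ⟨p, rfl⟩ := ENat.ne_top_iff_exists.1 (ne_top_of_lt (not_le.1 h1))
    obtain ⟨q, rfl⟩ := ENat.ne_top_iff_exists.1 (ne_top_of_lt (not_le.1 h2))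
    norm_cast at h1 h2 hab
    have h3 := add_le_add (ha p (by omega) le_rfl) (hb q (by omega) le_rfl)
    refine le_trans ?_ h3
    exact_mod_cast hab
  exact ⟨key (fun k hk => (hx k hk).1) fun k hk => (hy k hk).1,
    key (fun k hk => (hx k hk).2) fun k hk => (hy k hk).2⟩

theorem encard_sep_insert {W T : Type*} (S : W → Prop) (f : W → T) {t : T} {Q : Set T}
    (ht : t ∉ Q) : {v | S v ∧ f v ∈ insert t Q}.encard =
      {v | S v ∧ f v = t}.encard + {v | S v ∧ f v ∈ Q}.encard := by
  rw [← encard_union_eq]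
  · congr 1
    ext v
    simp only [mem_insert_iff, mem_ofPred_eq, mem_union]
    tauto
  · rw [disjoint_left]
    rintro v ⟨_, rfl⟩ ⟨_, hv⟩
    exact ht hv

/-- Passes from counts of single colours to counts of a set of colours, such as all the theories
containing a given formula. -/
theorem le_encard_iff_of_succs {W W' T : Type*} [Finite T] {R : W → W → Prop}
    {R' : W' → W' → Prop} {tp : W → T} {tp' : W' → T} {w : W} {w' : W'} {K : ℕ}
    (h : ∀ t, ∀ k ≤ K, (k : ℕ∞) ≤ (succs R tp w t).encard ↔
      (k : ℕ∞) ≤ (succs R' tp' w' t).encard) (Q : Set T) :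
    ∀ k ≤ K, (k : ℕ∞) ≤ {v | R w v ∧ tp v ∈ Q}.encard ↔
      (k : ℕ∞) ≤ {v | R' w' v ∧ tp' v ∈ Q}.encard := by
  induction Q, Q.toFinite using Set.Finite.induction_on with
  | empty => intro k _; simp
  | @insert t Q ht _ ih =>
    intro k hk
    rw [encard_sep_insert _ _ ht, encard_sep_insert _ _ ht]
    exact le_add_iff_of_le_iff (h t) ih hk

/-! ### The finite model and preservation of truth -/

/-- The formulas of Gödel number less than `m` that are true at a world. -/
def theory (M : Model.{u}) (m : ℕ) (w : M.World) : Set (Fin m) :=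
  {k | Sat M w (Formula.ofNat k)}

theorem mem_theory {M : Model.{u}} {m : ℕ} {w : M.World} {ψ : Formula} (h : ψ.toNat < m) :
    (⟨ψ.toNat, h⟩ : Fin m) ∈ theory M m w ↔ Sat M w ψ := by
  simp [theory, Formula.ofNat_toNat]

/-- The number of labels that suffices for formulas of Gödel number less than `m`. -/
def labelBound (m : ℕ) : ℕ := (m + 1) * heredBound (2 ^ m) m

theorem heredBound_le_labelBound (m : ℕ) : heredBound (2 ^ m) m ≤ labelBound m :=
  Nat.le_mul_of_pos_left _ (Nat.succ_pos m)

theorem card_set_fin (m : ℕ) : Fintype.card (Set (Fin m)) = 2 ^ m := by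
  rw [Fintype.card_set, Fintype.card_fin]

/-- The finite model obtained from a transitive one. -/
noncomputable def compress (M : Model.{u}) (m : ℕ)
    (hM : ∀ x y z : M.World, M.R x y → M.R y z → M.R x z) : Model.{u} where
  World := ULift.{u} (Compressed M.R (theory M m) m (labelBound m))
  nonempty := by
    obtain ⟨w⟩ := M.nonempty
    obtain ⟨a, -⟩ := Compressed.exists_labelled (tp := theory M m) (K := m) (N := labelBound m) hM
      (by rw [card_set_fin]; exact heredBound_le_labelBound m) w
    exact ⟨⟨a.pt⟩⟩
  R c d := c.down.Rel d.down
  V p := {c | c.down.rep.world ∈ M.V p}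

section

variable {M : Model.{u}} {m : ℕ} (hM : ∀ x y z : M.World, M.R x y → M.R y z → M.R x z)

/-- The worlds of the finite model are the points of the finite frame. -/
def compressEquiv : (compress M m hM).World ≃
    Compressed M.R (theory M m) m (labelBound m) := Equiv.ulift

theorem le_encard_compress_iff (c : (compress M m hM).World) (Q : Set (Set (Fin m))) {k : ℕ}
    (hk : k ≤ m) :
    (k : ℕ∞) ≤ {d | (compress M m hM).R c d ∧ theory M m (compressEquiv hM d).rep.world ∈ Q}.encard ↔
      (k : ℕ∞) ≤ {v | M.R (compressEquiv hM c).rep.world v ∧ theory M m v ∈ Q}.encard := by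
  have h1 := le_encard_iff_of_succs (fun t k hk => Compressed.le_encard_succs_iff
    (tp := theory M m) (K := m) (N := labelBound m) hM (by rw [card_set_fin]; rfl) (compressEquiv hM c) t hk)
    Q k hk
  rw [← h1]
  have h2 : {d : (compress M m hM).World | (compress M m hM).R c d ∧
      theory M m (compressEquiv hM d).rep.world ∈ Q} = (compressEquiv hM).symm '' {d | (compressEquiv hM c).Rel d ∧
      theory M m d.rep.world ∈ Q} := by
    rw [Equiv.image_eq_preimage_symm]
    rfl
  rw [h2, (compressEquiv hM).symm.injective.encard_image]

/-- Truth lemma. Subformulas have smaller Gödel numbers and so stay below `m`; graded modalities use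
the truncated counts, the converse modality uses `bwd_rel_eq`. -/
theorem sat_compress (ψ : Formula) (hψ : ψ.toNat < m) (c : (compress M m hM).World) :
    Sat (compress M m hM) c ψ ↔ Sat M (compressEquiv hM c).rep.world ψ := by
  induction ψ generalizing c with
  | var p => exact Iff.rfl
  | neg ψ ih =>
    have h : ψ.toNat < m := by rw [Formula.toNat] at hψ; omega
    exact not_congr (ih h c)
  | and ψ χ ih1 ih2 =>
    rw [Formula.toNat] at hψ
    have h1 := Nat.left_le_pair ψ.toNat χ.toNat
    have h2 := Nat.right_le_pair ψ.toNat χ.toNat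
    exact and_congr (ih1 (by omega) c) (ih2 (by omega) c)
  | dia n ψ ih =>
    rw [Formula.toNat] at hψ
    have h1 := Nat.left_le_pair n ψ.toNat
    have h2 := Nat.right_le_pair n ψ.toNat
    have h : ψ.toNat < m := by omega
    -- The grade satisfies `n ≤ m` because it is a component of the Gödel number of the formula.
    have key := le_encard_compress_iff hM c {t | (⟨ψ.toNat, h⟩ : Fin m) ∈ t} (k := n) (by omega)
    simp only [mem_ofPred_eq, mem_theory h, ← ih h] at key
    exact key
  | cdia ψ ih =>
    have h : ψ.toNat < m := by rw [Formula.toNat] at hψ; omega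
    have hb := Compressed.bwd_rel_eq (tp := theory M m) (K := m) (N := labelBound m) hM
      (by rw [card_set_fin]; exact heredBound_le_labelBound m) (compressEquiv hM c)
    constructor
    · rintro ⟨d, hd, hs⟩
      obtain ⟨u, hu, ht⟩ := hb.subset ⟨(compressEquiv hM d), hd, rfl⟩
      exact ⟨u, hu, by rwa [← mem_theory h, ht, mem_theory h, ← ih h]⟩
    · rintro ⟨u, hu, hs⟩
      obtain ⟨d, hd, ht⟩ := hb.superset ⟨u, hu, rfl⟩
      refine ⟨(compressEquiv hM).symm d, hd, ?_⟩
      rw [ih h, Equiv.apply_symm_apply, ← mem_theory h]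
      exact (congrArg (_ ∈ ·) ht).mpr ((mem_theory h).2 hs)

theorem exists_sat_compress_iff (w : M.World) : ∃ c : (compress M m hM).World,
    ∀ ψ : Formula, ψ.toNat < m → (Sat (compress M m hM) c ψ ↔ Sat M w ψ) := by
  obtain ⟨a, rfl⟩ := Compressed.exists_labelled (tp := theory M m) (K := m) (N := labelBound m) hM
      (by rw [card_set_fin]; exact heredBound_le_labelBound m) w
  refine ⟨(compressEquiv hM).symm a.pt, fun ψ h => ?_⟩
  rw [sat_compress hM ψ h, Equiv.apply_symm_apply, ← mem_theory h, Compressed.tp_rep_pt a, mem_theory h]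

theorem compress_trans (x y z : (compress M m hM).World) :
    (compress M m hM).R x y → (compress M m hM).R y z → (compress M m hM).R x z :=
  Compressed.rel_trans

theorem compress_refl (hrefl : ∀ x, M.R x x) (x : (compress M m hM).World) :
    (compress M m hM).R x x :=
  Compressed.rel_refl hM hrefl ((compressEquiv hM) x)

theorem compress_serial (hm : 1 ≤ m) (hser : ∀ x, ∃ y, M.R x y) (x : (compress M m hM).World) :
    ∃ y, (compress M m hM).R x y := by
  -- Seriality says that the number of successors of arbitrary colour is at least one, which is
  -- below the threshold as `1 ≤ m`.
  have key := (le_encard_compress_iff hM x univ hm).2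
  simp only [mem_univ, and_true, Nat.cast_one, one_le_encard_iff_nonempty] at key
  exact key (hser _)

instance : Finite (compress M m hM).World :=
  inferInstanceAs (Finite (ULift (Compressed M.R (theory M m) m (labelBound m))))

/-- A bound for the number of worlds of the finite model. -/
def worldBound (m : ℕ) : ℕ :=
  labelBound m * 2 ^ (labelBound m * (2 ^ m * (2 ^ (2 ^ m * (m + 1)) * 2 ^ 2 ^ m) *
    2 ^ labelBound m))

theorem card_compress_le : Nat.card (compress M m hM).World ≤ worldBound m := by
  have h := Compressed.card_le (R := M.R) (tp := theory M m) (K := m) (N := labelBound m)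
  rw [card_set_fin] at h
  exact (Nat.card_congr (compressEquiv hM)).le.trans h

end

theorem trans_of_mem {C : FrameClass.{u}} (hC : C ∈ ({K4.{u}, D4.{u}, S4.{u}} : Set FrameClass.{u}))
    {F : Frame.{u}} (hF : F ∈ C) : ∀ x y z : F.World, F.R x y → F.R y z → F.R x z := by
  rcases hC with rfl | rfl | rfl
  · exact hF
  · exact hF.2
  · exact hF.2

theorem compress_mem {C : FrameClass.{u}} (hC : C ∈ ({K4.{u}, D4.{u}, S4.{u}} : Set FrameClass.{u}))
    {M : Model.{u}} (hM : M.toFrame ∈ C) {m : ℕ} (hm : 1 ≤ m) :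
    (compress M m (trans_of_mem hC hM)).toFrame ∈ C := by
  have ht := compress_trans (m := m) (trans_of_mem hC hM)
  rcases hC with rfl | rfl | rfl
  · exact ht
  · exact ⟨compress_serial _ hm hM.1, ht⟩
  · exact ⟨compress_refl _ hM.1, ht⟩

/-- A satisfiable formula is satisfiable in a model of bounded size. -/
theorem LocallySatisfiable.exists_bounded {C : FrameClass.{u}}
    (hC : C ∈ ({K4.{u}, D4.{u}, S4.{u}} : Set FrameClass.{u})) {φ : Formula}
    (h : LocallySatisfiable C φ) : ∃ M : Model.{u}, M.toFrame ∈ C ∧ Finite M.World ∧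
      Nat.card M.World ≤ worldBound (φ.toNat + 1) ∧ ∃ w, Sat M w φ := by
  obtain ⟨M, hM, w, hw⟩ := h
  have ht := trans_of_mem hC hM
  obtain ⟨c, hc⟩ := exists_sat_compress_iff (m := φ.toNat + 1) ht w
  exact ⟨_, compress_mem hC hM (by omega), inferInstance, card_compress_le ht, c,
    (hc φ (by omega)).2 hw⟩

/-- A globally satisfiable formula is globally satisfiable in a model of bounded size. -/
theorem GloballySatisfiable.exists_bounded {C : FrameClass.{u}}
    (hC : C ∈ ({K4.{u}, D4.{u}, S4.{u}} : Set FrameClass.{u})) {φ : Formula}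
    (h : GloballySatisfiable C φ) : ∃ M : Model.{u}, M.toFrame ∈ C ∧ Finite M.World ∧
      Nat.card M.World ≤ worldBound (φ.toNat + 1) ∧ ∀ w, Sat M w φ := by
  obtain ⟨M, hM, hw⟩ := h
  have ht := trans_of_mem hC hM
  exact ⟨_, compress_mem hC hM (by omega), inferInstance, card_compress_le ht, fun c =>
    (sat_compress ht (m := φ.toNat + 1) φ (by omega) c).2 (hw _)⟩

/-! ### Primitive recursion with bounded quantifiers -/

section Primrec

variable {α : Type*} [Primcodable α]

theorem primrecPred_imp {p q : α → Prop} (hp : PrimrecPred p) (hq : PrimrecPred q) :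
    PrimrecPred fun a => p a → q a :=
  (hp.not.or hq).of_eq fun _ => imp_iff_not_or.symm

theorem primrecPred_iff {p q : α → Prop} (hp : PrimrecPred p) (hq : PrimrecPred q) :
    PrimrecPred fun a => p a ↔ q a :=
  ((primrecPred_imp hp hq).and (primrecPred_imp hq hp)).of_eq fun _ => iff_def.symm

theorem primrecPred_exists_lt {f : α → ℕ} {p : α × ℕ → Prop} (hf : Primrec f)
    (hp : PrimrecPred p) : PrimrecPred fun a => ∃ x < f a, p (a, x) := by
  have hR : PrimrecRel fun (x : ℕ) (a : α) => p (a, x) :=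
    hp.comp (Primrec.pair Primrec.snd Primrec.fst)
  exact (hR.exists_mem_list.comp (Primrec.list_range.comp hf) Primrec.id).of_eq fun a => by simp

theorem primrecPred_forall_lt {f : α → ℕ} {p : α × ℕ → Prop} (hf : Primrec f)
    (hp : PrimrecPred p) : PrimrecPred fun a => ∀ x < f a, p (a, x) := by
  have hR : PrimrecRel fun (x : ℕ) (a : α) => p (a, x) :=
    hp.comp (Primrec.pair Primrec.snd Primrec.fst)
  exact (hR.forall_mem_list.comp (Primrec.list_range.comp hf) Primrec.id).of_eq fun a => by simp

theorem primrec_count {f : α → ℕ} {p : α × ℕ → Prop} [DecidablePred p] (hf : Primrec f)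
    (hp : PrimrecPred p) : Primrec fun a => Nat.count (fun x => p (a, x)) (f a) := by
  have hR : PrimrecRel fun (x : ℕ) (a : α) => p (a, x) :=
    hp.comp (Primrec.pair Primrec.snd Primrec.fst)
  refine (Primrec.list_length.comp
    (hR.listFilter.comp (Primrec.list_range.comp hf) Primrec.id)).of_eq fun a => ?_
  rw [← List.countP_eq_length_filter]
  rfl

theorem primrec_pow {f g : α → ℕ} (hf : Primrec f) (hg : Primrec g) :
    Primrec fun a => f a ^ g a :=
  (Primrec₂.unpaired'.1 Nat.Primrec.pow).comp hf hg

theorem primrec_mul {f g : α → ℕ} (hf : Primrec f) (hg : Primrec g) :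
    Primrec fun a => f a * g a := Primrec.nat_mul.comp hf hg

theorem primrec_add {f g : α → ℕ} (hf : Primrec f) (hg : Primrec g) :
    Primrec fun a => f a + g a := Primrec.nat_add.comp hf hg

theorem primrecPred_testBit {f g : α → ℕ} (hf : Primrec f) (hg : Primrec g) :
    PrimrecPred fun a => (f a).testBit (g a) = true := by
  refine PrimrecPred.of_eq (Primrec.eq.comp (Primrec.nat_mod.comp
    (Primrec.nat_div.comp hf (primrec_pow (Primrec.const 2) hg)) (Primrec.const 2))
    (Primrec.const 1)) fun a => ?_
  rw [Nat.testBit_eq_decide_div_mod_eq, decide_eq_true_iff]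

end Primrec

/-! ### Finite structures and truth tables as numbers -/

/-- The entry of a binary matrix with rows of length `n`, coded by the number `c`. -/
def Entry (n c x y : ℕ) : Prop := c.testBit (x * n + y) = true

instance (n c x y : ℕ) : Decidable (Entry n c x y) := inferInstanceAs (Decidable (_ = true))

theorem exists_entry_iff (Q : ℕ → ℕ → Prop) (m n : ℕ) :
    ∃ c < 2 ^ (m * n), ∀ x < m, ∀ y < n, Entry n c x y ↔ Q x y := by
  classical
  refine ⟨Nat.ofBits fun i : Fin (m * n) => decide (Q (i / n) (i % n)),
    Nat.ofBits_lt_two_pow _, fun x hx y hy => ?_⟩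
  have hlt : x * n + y < m * n := by nlinarith
  have h1 : (x * n + y) / n = x := by
    rw [mul_comm, Nat.mul_add_div (by omega), Nat.div_eq_of_lt hy, add_zero]
  have h2 : (x * n + y) % n = y := by
    rw [mul_comm, Nat.mul_add_mod, Nat.mod_eq_of_lt hy]
  rw [Entry, Nat.testBit_ofBits_lt _ _ hlt, decide_eq_true_iff]
  simp only [h1, h2]

/-- The truth condition of the formula with Gödel number `k` at the world `w`, in a structure with
the worlds `x < n`, an accessibility relation coded by `r` and a truth table coded by `s`. -/
def TruthCondition (n r s k w : ℕ) : Prop :=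
  (k % 5 = 1 ∧ ¬ Entry n s (k / 5) w) ∨
  (k % 5 = 2 ∧ Entry n s (k / 5).unpair.1 w ∧ Entry n s (k / 5).unpair.2 w) ∨
  (k % 5 = 3 ∧ (k / 5).unpair.1 ≤
    Nat.count (fun v => Entry n r w v ∧ Entry n s (k / 5).unpair.2 v) n) ∨
  (k % 5 = 4 ∧ ∃ v < n, Entry n r v w ∧ Entry n s (k / 5) v)

/-- `s` codes a truth table for the formulas of Gödel number less than `m`. -/
def IsTruthTable (m n r s : ℕ) : Prop :=
  ∀ k < m, ∀ w < n, k % 5 ≠ 0 → (Entry n s k w ↔ TruthCondition n r s k w)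

section Semantics

variable {M : Model.{u}} {n : ℕ} (e : M.World ≃ Fin n) {m r s : ℕ}

/-- The first `m` rows of the matrix coded by `s` list the truth values of formulas. -/
def Tabulates (m s : ℕ) : Prop :=
  ∀ k < m, ∀ w, Sat M w (Formula.ofNat k) ↔ Entry n s k (e w)

variable {e}

theorem le_encard_iff_le_count (p : ℕ → Prop) [DecidablePred p] (k : ℕ) :
    (k : ℕ∞) ≤ {v | p (e v)}.encard ↔ k ≤ Nat.count p n := by
  have h : {v | p (e v)} = ((fun v => (e v : ℕ)) ⁻¹' {x | x < n ∧ p x}) := by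
    ext v; simp
  have hinj : Function.Injective fun v => (e v : ℕ) := Fin.val_injective.comp e.injective
  have hcard : {v | p (e v)}.encard = Nat.count p n := by
    rw [h, ← hinj.encard_image, image_preimage_eq_of_subset, Nat.count_eq_card_filter_range,
      ← encard_coe_eq_coe_finsetCard]
    · congr 1
      ext x; simp
    · rintro x ⟨hx, -⟩
      exact ⟨e.symm ⟨x, hx⟩, by simp⟩
  rw [hcard, Nat.cast_le]

theorem sat_ofNat_iff_truthCondition (hr : ∀ v w, M.R v w ↔ Entry n r (e v) (e w)) {k : ℕ}
    (hs : Tabulates e k s) (h0 : k % 5 ≠ 0) (w : M.World) :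
    Sat M w (Formula.ofNat k) ↔ TruthCondition n r s k (e w) := by
  -- Since `k % 5 ≠ 0` excludes `k = 0`, the truth condition only consults earlier rows of the
  -- table.
  have hk : k / 5 < k := by omega
  have h1 := (Nat.unpair_left_le (k / 5)).trans_lt hk
  have h2 := (Nat.unpair_right_le (k / 5)).trans_lt hk
  have h5 : k % 5 = 1 ∨ k % 5 = 2 ∨ k % 5 = 3 ∨ k % 5 = 4 := by omega
  rw [Formula.ofNat, TruthCondition]
  rcases h5 with h | h | h | h <;> simp only [h, reduceIte,
    OfNat.one_ne_ofNat, OfNat.ofNat_ne_one, OfNat.ofNat_ne_zero, one_ne_zero, Nat.reduceEqDiff,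
    false_and, true_and, or_false, false_or]
  · exact not_congr (hs _ hk w)
  · exact and_congr (hs _ h1 w) (hs _ h2 w)
  · rw [← le_encard_iff_le_count (e := e)]
    simp only [← hr, ← hs _ h2]
    rfl
  · constructor
    · rintro ⟨v, hv, h⟩
      exact ⟨e v, (e v).2, (hr v w).1 hv, (hs _ hk v).1 h⟩
    · rintro ⟨v, hv, hvw, h⟩
      refine ⟨e.symm ⟨v, hv⟩, (hr _ _).2 ?_, (hs _ hk _).2 ?_⟩ <;> simpa

theorem Tabulates.isTruthTable (hr : ∀ v w, M.R v w ↔ Entry n r (e v) (e w))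
    (hs : Tabulates e m s) : IsTruthTable m n r s := by
  intro k hk w hw h0
  have h := sat_ofNat_iff_truthCondition hr (fun j hj => hs j (hj.trans hk)) h0 (e.symm ⟨w, hw⟩)
  rw [hs k hk] at h
  simpa using h

/-- The rows with `k % 5 = 0` are unconstrained and serve as the valuation; every other row is
forced by earlier ones, so strong induction on `k` applies. -/
theorem IsTruthTable.tabulates (hr : ∀ v w, M.R v w ↔ Entry n r (e v) (e w))
    (hV : ∀ p w, w ∈ M.V p ↔ Entry n s (5 * p) (e w)) (hs : IsTruthTable m n r s) :
    Tabulates e m s := by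
  intro k
  induction k using Nat.strong_induction_on with
  | _ k ih =>
    intro hk w
    by_cases h0 : k % 5 = 0
    · have h5 : 5 * (k / 5) = k := by omega
      rw [Formula.ofNat, if_pos h0]
      have := hV (k / 5) w
      rwa [h5] at this
    · rw [sat_ofNat_iff_truthCondition hr (fun j hj => ih j hj (hj.trans hk)) h0,
        hs k hk _ (e w).2 h0]

/-- Every model with `n` worlds is coded by numbers. -/
theorem exists_codes (e : M.World ≃ Fin n) (m : ℕ) : ∃ r < 2 ^ (n * n), ∃ s < 2 ^ (m * n),
    (∀ v w, M.R v w ↔ Entry n r (e v) (e w)) ∧ Tabulates e m s := by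
  obtain ⟨r, hr, hr'⟩ := exists_entry_iff
    (fun x y => ∃ v w, (e v : ℕ) = x ∧ (e w : ℕ) = y ∧ M.R v w) n n
  obtain ⟨s, hs, hs'⟩ := exists_entry_iff
    (fun k y => ∃ w, (e w : ℕ) = y ∧ Sat M w (Formula.ofNat k)) m n
  refine ⟨r, hr, s, hs, fun v w => ?_, fun k hk w => ?_⟩
  · rw [hr' _ (e v).2 _ (e w).2]
    simp [Fin.val_inj]
  · rw [hs' k hk _ (e w).2]
    simp [Fin.val_inj]

/-- Every truth table is the truth table of a model. -/
theorem IsTruthTable.exists_model (hn : 0 < n) (hs : IsTruthTable m n r s) :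
    ∃ (M : Model.{u}) (e : M.World ≃ Fin n),
      (∀ v w, M.R v w ↔ Entry n r (e v) (e w)) ∧ Tabulates e m s := by
  let M : Model.{u} :=
    { World := ULift.{u} (Fin n)
      nonempty := ⟨⟨⟨0, hn⟩⟩⟩
      R := fun v w => Entry n r v.down w.down
      V := fun p => {w | Entry n s (5 * p) w.down} }
  have hr : ∀ v w : M.World, M.R v w ↔ Entry n r (Equiv.ulift v) (Equiv.ulift w) :=
    fun _ _ => Iff.rfl
  exact ⟨M, Equiv.ulift, hr, hs.tabulates hr fun _ _ => Iff.rfl⟩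

end Semantics

/-! ### Satisfiability as a bounded search -/

/-- Membership in the frame class `C` is expressed by the predicate `P` on codes. -/
def CodedBy (C : FrameClass.{u}) (P : ℕ × ℕ → Prop) : Prop :=
  ∀ (F : Frame.{u}) (n r : ℕ) (e : F.World ≃ Fin n),
    (∀ v w, F.R v w ↔ Entry n r (e v) (e w)) → (F ∈ C ↔ P (n, r))

theorem forall_world_iff {W : Type*} {n : ℕ} (e : W ≃ Fin n) (p : ℕ → Prop) :
    (∀ v, p (e v)) ↔ ∀ x < n, p x :=
  ⟨fun h x hx => by simpa using h (e.symm ⟨x, hx⟩), fun h v => h _ (e v).2⟩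

theorem exists_world_iff {W : Type*} {n : ℕ} (e : W ≃ Fin n) (p : ℕ → Prop) :
    (∃ v, p (e v)) ↔ ∃ x < n, p x :=
  ⟨fun ⟨v, h⟩ => ⟨_, (e v).2, h⟩, fun ⟨x, hx, h⟩ => ⟨e.symm ⟨x, hx⟩, by simpa using h⟩⟩

/-- Forwards, the bounded model is coded by its relation and truth table. Backwards, any correct
table yields a model, so the bounds are not needed there. -/
theorem locallySatisfiable_iff_exists_codes {C : FrameClass.{u}}
    (hC : C ∈ ({K4.{u}, D4.{u}, S4.{u}} : Set FrameClass.{u})) {P : ℕ × ℕ → Prop}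
    (hP : CodedBy C P) (φ : Formula) : LocallySatisfiable C φ ↔
      ∃ n < worldBound (φ.toNat + 1) + 1, ∃ r < 2 ^ (n * n), ∃ s < 2 ^ ((φ.toNat + 1) * n),
        P (n, r) ∧ IsTruthTable (φ.toNat + 1) n r s ∧ ∃ w < n, Entry n s φ.toNat w := by
  have hφ : φ.toNat < φ.toNat + 1 := by omega
  constructor
  · intro h
    obtain ⟨M, hM, _, hcard, w, hw⟩ := h.exists_bounded hC
    let e := Finite.equivFin M.World
    obtain ⟨r, hr, s, hs, hR, ht⟩ := exists_codes e (φ.toNat + 1)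
    refine ⟨_, Nat.lt_succ_of_le hcard, r, hr, s, hs, (hP _ _ r e hR).1 hM, ht.isTruthTable hR,
      e w, (e w).2, ?_⟩
    rwa [← ht _ hφ, Formula.ofNat_toNat]
  · rintro ⟨n, -, r, -, s, -, hPn, ht, w, hw, hs⟩
    obtain ⟨M, e, hR, hT⟩ := ht.exists_model (by omega)
    refine ⟨M, (hP _ n r e hR).2 hPn, e.symm ⟨w, hw⟩, ?_⟩
    have := hT _ hφ (e.symm ⟨w, hw⟩)
    rw [Formula.ofNat_toNat, Equiv.apply_symm_apply] at this
    exact this.2 hs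

theorem globallySatisfiable_iff_exists_codes {C : FrameClass.{u}}
    (hC : C ∈ ({K4.{u}, D4.{u}, S4.{u}} : Set FrameClass.{u})) {P : ℕ × ℕ → Prop}
    (hP : CodedBy C P) (φ : Formula) : GloballySatisfiable C φ ↔
      ∃ n < worldBound (φ.toNat + 1) + 1, ∃ r < 2 ^ (n * n), ∃ s < 2 ^ ((φ.toNat + 1) * n),
        P (n, r) ∧ IsTruthTable (φ.toNat + 1) n r s ∧ 0 < n ∧ ∀ w < n, Entry n s φ.toNat w := by
  have hφ : φ.toNat < φ.toNat + 1 := by omega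
  constructor
  · intro h
    obtain ⟨M, hM, _, hcard, hw⟩ := h.exists_bounded hC
    let e := Finite.equivFin M.World
    obtain ⟨r, hr, s, hs, hR, ht⟩ := exists_codes e (φ.toNat + 1)
    have := M.nonempty
    -- Positivity of `n` is recorded separately: unlike in the local case, no witness world supplies
    -- it.
    refine ⟨_, Nat.lt_succ_of_le hcard, r, hr, s, hs, (hP _ _ r e hR).1 hM, ht.isTruthTable hR,
      Nat.card_pos, (forall_world_iff e _).1 fun w => ?_⟩
    rw [← ht _ hφ, Formula.ofNat_toNat]
    exact hw w
  · rintro ⟨n, -, r, -, s, -, hPn, ht, hn, hs⟩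
    obtain ⟨M, e, hR, hT⟩ := ht.exists_model hn
    refine ⟨M, (hP _ n r e hR).2 hPn, fun w => ?_⟩
    have := hT _ hφ w
    rw [Formula.ofNat_toNat] at this
    exact this.2 (hs _ (e w).2)

/-- Transitivity of a coded relation. -/
def TransCode (a : ℕ × ℕ) : Prop :=
  ∀ x < a.1, ∀ y < a.1, ∀ z < a.1, Entry a.1 a.2 x y → Entry a.1 a.2 y z → Entry a.1 a.2 x z

/-- Seriality of a coded relation. -/
def SerialCode (a : ℕ × ℕ) : Prop := ∀ x < a.1, ∃ y < a.1, Entry a.1 a.2 x y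

/-- Reflexivity of a coded relation. -/
def ReflCode (a : ℕ × ℕ) : Prop := ∀ x < a.1, Entry a.1 a.2 x x

theorem codedBy_K4 : CodedBy K4.{u} TransCode := by
  intro F n r e h
  simp only [TransCode, ← forall_world_iff e, ← h]
  rfl

theorem codedBy_D4 : CodedBy D4.{u} fun a => SerialCode a ∧ TransCode a := by
  intro F n r e h
  simp only [SerialCode, TransCode, ← forall_world_iff e, ← exists_world_iff e, ← h]
  rfl

theorem codedBy_S4 : CodedBy S4.{u} fun a => ReflCode a ∧ TransCode a := by
  intro F n r e h
  simp only [ReflCode, TransCode, ← forall_world_iff e, ← h]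
  rfl

/-! ### Primitive recursiveness of the search -/

section Primrec

variable {α : Type*} [Primcodable α]

open Primrec

theorem primrecPred_entry {n c x y : α → ℕ} (hn : Primrec n) (hc : Primrec c) (hx : Primrec x)
    (hy : Primrec y) : PrimrecPred fun a => Entry (n a) (c a) (x a) (y a) :=
  primrecPred_testBit hc (primrec_add (primrec_mul hx hn) hy)

theorem primrecPred_transCode : PrimrecPred TransCode := by
  have hn : Primrec fun a : ((((ℕ × ℕ) × ℕ) × ℕ) × ℕ) => a.1.1.1.1 :=
    fst.comp (fst.comp (fst.comp fst))
  have hr : Primrec fun a : ((((ℕ × ℕ) × ℕ) × ℕ) × ℕ) => a.1.1.1.2 :=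
    snd.comp (fst.comp (fst.comp fst))
  have hx : Primrec fun a : ((((ℕ × ℕ) × ℕ) × ℕ) × ℕ) => a.1.1.2 := snd.comp (fst.comp fst)
  have hy : Primrec fun a : ((((ℕ × ℕ) × ℕ) × ℕ) × ℕ) => a.1.2 := snd.comp fst
  exact primrecPred_forall_lt fst (primrecPred_forall_lt (fst.comp fst)
    (primrecPred_forall_lt (fst.comp (fst.comp fst))
      (primrecPred_imp (primrecPred_entry hn hr hx hy)
        (primrecPred_imp (primrecPred_entry hn hr hy snd) (primrecPred_entry hn hr hx snd)))))

theorem primrecPred_serialCode : PrimrecPred SerialCode :=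
  primrecPred_forall_lt fst (primrecPred_exists_lt (fst.comp fst)
    (primrecPred_entry (fst.comp (fst.comp fst)) (snd.comp (fst.comp fst)) (snd.comp fst) snd))

theorem primrecPred_reflCode : PrimrecPred ReflCode :=
  primrecPred_forall_lt fst (primrecPred_entry (fst.comp fst) (snd.comp fst) snd snd)

theorem primrecPred_truthCondition {n r s k w : α → ℕ} (hn : Primrec n) (hr : Primrec r)
    (hs : Primrec s) (hk : Primrec k) (hw : Primrec w) :
    PrimrecPred fun a => TruthCondition (n a) (r a) (s a) (k a) (w a) := by
  have hd : Primrec fun a => k a / 5 := nat_div.comp hk (const 5)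
  have hd1 : Primrec fun a => (k a / 5).unpair.1 := fst.comp (unpair.comp hd)
  have hd2 : Primrec fun a => (k a / 5).unpair.2 := snd.comp (unpair.comp hd)
  have hm : ∀ i : ℕ, PrimrecPred fun a => k a % 5 = i := fun i =>
    Primrec.eq.comp (nat_mod.comp hk (const 5)) (const i)
  have lift : ∀ {f : α → ℕ}, Primrec f → Primrec fun a : α × ℕ => f a.1 := fun h => h.comp fst
  have h3 : Primrec fun a => Nat.count (fun v => Entry (n a) (r a) (w a) v ∧
      Entry (n a) (s a) (k a / 5).unpair.2 v) (n a) :=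
    primrec_count (p := fun b : α × ℕ => Entry (n b.1) (r b.1) (w b.1) b.2 ∧
      Entry (n b.1) (s b.1) (k b.1 / 5).unpair.2 b.2) hn
      ((primrecPred_entry (lift hn) (lift hr) (lift hw) snd).and
        (primrecPred_entry (lift hn) (lift hs) (lift hd2) snd))
  have h4 : PrimrecPred fun a => ∃ v < n a, Entry (n a) (r a) v (w a) ∧
      Entry (n a) (s a) (k a / 5) v :=
    primrecPred_exists_lt (p := fun b : α × ℕ => Entry (n b.1) (r b.1) b.2 (w b.1) ∧
      Entry (n b.1) (s b.1) (k b.1 / 5) b.2) hn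
      ((primrecPred_entry (lift hn) (lift hr) snd (lift hw)).and
        (primrecPred_entry (lift hn) (lift hs) (lift hd) snd))
  exact ((hm 1).and (primrecPred_entry hn hs hd hw).not).or
    (((hm 2).and ((primrecPred_entry hn hs hd1 hw).and (primrecPred_entry hn hs hd2 hw))).or
      (((hm 3).and (nat_le.comp hd1 h3)).or ((hm 4).and h4)))

theorem primrecPred_isTruthTable {m n r s : α → ℕ} (hm : Primrec m) (hn : Primrec n)
    (hr : Primrec r) (hs : Primrec s) :
    PrimrecPred fun a => IsTruthTable (m a) (n a) (r a) (s a) := by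
  have lift : ∀ {f : α → ℕ}, Primrec f → Primrec fun a : (α × ℕ) × ℕ => f a.1.1 := fun h =>
    h.comp (fst.comp fst)
  have hk : Primrec fun a : (α × ℕ) × ℕ => a.1.2 := snd.comp fst
  have h0 : PrimrecPred fun a : (α × ℕ) × ℕ => a.1.2 % 5 ≠ 0 :=
    (Primrec.eq.comp (nat_mod.comp hk (const 5)) (const 0)).not
  exact primrecPred_forall_lt
    (p := fun b : α × ℕ => ∀ w < n b.1, b.2 % 5 ≠ 0 → (Entry (n b.1) (s b.1) b.2 w ↔
      TruthCondition (n b.1) (r b.1) (s b.1) b.2 w)) hm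
    (primrecPred_forall_lt (p := fun c : (α × ℕ) × ℕ => c.1.2 % 5 ≠ 0 →
      (Entry (n c.1.1) (s c.1.1) c.1.2 c.2 ↔
        TruthCondition (n c.1.1) (r c.1.1) (s c.1.1) c.1.2 c.2)) (hn.comp fst)
      (primrecPred_imp h0 (primrecPred_iff (primrecPred_entry (lift hn) (lift hs) hk snd)
        (primrecPred_truthCondition (lift hn) (lift hr) (lift hs) hk snd))))

theorem primrec_heredBound {t k : α → ℕ} (ht : Primrec t) (hk : Primrec k) :
    Primrec fun a => heredBound (t a) (k a) :=
  primrec_pow (primrec_add (primrec_mul ht hk) (const 1))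
    (primrec_add (primrec_mul ht (primrec_add hk (const 1))) (const 1))

theorem primrec_worldBound : Primrec worldBound := by
  have hm1 : Primrec fun m : ℕ => m + 1 := primrec_add Primrec.id (const 1)
  have ht : Primrec fun m : ℕ => 2 ^ m := primrec_pow (const 2) Primrec.id
  have hL : Primrec labelBound := primrec_mul hm1 (primrec_heredBound ht Primrec.id)
  exact primrec_mul hL (primrec_pow (const 2) (primrec_mul hL (primrec_mul (primrec_mul ht
    (primrec_mul (primrec_pow (const 2) (primrec_mul ht hm1)) (primrec_pow (const 2) ht)))
    (primrec_pow (const 2) hL))))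

theorem primrec_toNat : Primrec Formula.toNat := Primrec.encode

/-- Search for a coded model of bounded size is primitive recursive. -/
theorem primrecPred_exists_codes {P : ℕ × ℕ → Prop} (hP : PrimrecPred P)
    {Q : ((Formula × ℕ) × ℕ) × ℕ → Prop} (hQ : PrimrecPred Q) :
    PrimrecPred fun φ : Formula =>
      ∃ n < worldBound (φ.toNat + 1) + 1, ∃ r < 2 ^ (n * n), ∃ s < 2 ^ ((φ.toNat + 1) * n),
        P (n, r) ∧ IsTruthTable (φ.toNat + 1) n r s ∧ Q (((φ, n), r), s) := by
  have hm : Primrec fun φ : Formula => φ.toNat + 1 := primrec_add primrec_toNat (const 1)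
  have hn : Primrec fun a : ((Formula × ℕ) × ℕ) × ℕ => a.1.1.2 := snd.comp (fst.comp fst)
  have hr : Primrec fun a : ((Formula × ℕ) × ℕ) × ℕ => a.1.2 := snd.comp fst
  exact primrecPred_exists_lt
    (p := fun b : Formula × ℕ => ∃ r < 2 ^ (b.2 * b.2), ∃ s < 2 ^ ((b.1.toNat + 1) * b.2),
      P (b.2, r) ∧ IsTruthTable (b.1.toNat + 1) b.2 r s ∧ Q ((b, r), s))
    (primrec_add (primrec_worldBound.comp hm) (const 1))
    (primrecPred_exists_lt
      (p := fun c : (Formula × ℕ) × ℕ => ∃ s < 2 ^ ((c.1.1.toNat + 1) * c.1.2),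
        P (c.1.2, c.2) ∧ IsTruthTable (c.1.1.toNat + 1) c.1.2 c.2 s ∧ Q (c, s))
      (primrec_pow (const 2) (primrec_mul snd snd))
      (primrecPred_exists_lt
        (p := fun d : ((Formula × ℕ) × ℕ) × ℕ => P (d.1.1.2, d.1.2) ∧
          IsTruthTable (d.1.1.1.toNat + 1) d.1.1.2 d.1.2 d.2 ∧ Q d)
        (primrec_pow (const 2) (primrec_mul (hm.comp (fst.comp fst)) (snd.comp fst)))
        ((hP.comp (hn.pair hr)).and ((primrecPred_isTruthTable
          (hm.comp (fst.comp (fst.comp fst))) hn hr snd).and hQ))))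

end Primrec

/-! ### Decidability and the finite model properties -/

theorem exists_primrecPred_codedBy {C : FrameClass.{u}}
    (hC : C ∈ ({K4.{u}, D4.{u}, S4.{u}} : Set FrameClass.{u})) :
    ∃ P, PrimrecPred P ∧ CodedBy C P := by
  rcases hC with rfl | rfl | rfl
  · exact ⟨_, primrecPred_transCode, codedBy_K4⟩
  · exact ⟨_, primrecPred_serialCode.and primrecPred_transCode, codedBy_D4⟩
  · exact ⟨_, primrecPred_reflCode.and primrecPred_transCode, codedBy_S4⟩

theorem computablePred_locallySatisfiable {C : FrameClass.{u}}
    (hC : C ∈ ({K4.{u}, D4.{u}, S4.{u}} : Set FrameClass.{u})) :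
    ComputablePred fun φ => LocallySatisfiable C φ := by
  obtain ⟨P, hP, hCP⟩ := exists_primrecPred_codedBy hC
  have hQ : PrimrecPred fun a : ((Formula × ℕ) × ℕ) × ℕ =>
      ∃ w < a.1.1.2, Entry a.1.1.2 a.2 a.1.1.1.toNat w := by
    have hn : Primrec fun a : ((Formula × ℕ) × ℕ) × ℕ => a.1.1.2 :=
      Primrec.snd.comp (Primrec.fst.comp Primrec.fst)
    have hφ : Primrec fun a : ((Formula × ℕ) × ℕ) × ℕ => a.1.1.1.toNat :=
      primrec_toNat.comp (Primrec.fst.comp (Primrec.fst.comp Primrec.fst))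
    exact primrecPred_exists_lt hn (primrecPred_entry (hn.comp Primrec.fst)
      (Primrec.snd.comp Primrec.fst) (hφ.comp Primrec.fst) Primrec.snd)
  exact ((primrecPred_exists_codes hP hQ).of_eq fun φ =>
    (locallySatisfiable_iff_exists_codes hC hCP φ).symm).computablePred

theorem computablePred_globallySatisfiable {C : FrameClass.{u}}
    (hC : C ∈ ({K4.{u}, D4.{u}, S4.{u}} : Set FrameClass.{u})) :
    ComputablePred fun φ => GloballySatisfiable C φ := by
  obtain ⟨P, hP, hCP⟩ := exists_primrecPred_codedBy hC
  have hQ : PrimrecPred fun a : ((Formula × ℕ) × ℕ) × ℕ =>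
      0 < a.1.1.2 ∧ ∀ w < a.1.1.2, Entry a.1.1.2 a.2 a.1.1.1.toNat w := by
    have hn : Primrec fun a : ((Formula × ℕ) × ℕ) × ℕ => a.1.1.2 :=
      Primrec.snd.comp (Primrec.fst.comp Primrec.fst)
    have hφ : Primrec fun a : ((Formula × ℕ) × ℕ) × ℕ => a.1.1.1.toNat :=
      primrec_toNat.comp (Primrec.fst.comp (Primrec.fst.comp Primrec.fst))
    exact (Primrec.nat_lt.comp (Primrec.const 0) hn).and
      (primrecPred_forall_lt hn (primrecPred_entry (hn.comp Primrec.fst)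
        (Primrec.snd.comp Primrec.fst) (hφ.comp Primrec.fst) Primrec.snd))
  exact ((primrecPred_exists_codes hP hQ).of_eq fun φ =>
    (globallySatisfiable_iff_exists_codes hC hCP φ).symm).computablePred

theorem finiteLocalModelProperty {C : FrameClass.{u}}
    (hC : C ∈ ({K4.{u}, D4.{u}, S4.{u}} : Set FrameClass.{u})) : FiniteLocalModelProperty C := by
  intro φ h
  obtain ⟨M, hM, hfin, -, hw⟩ := h.exists_bounded hC
  exact ⟨M, ⟨hM, hfin⟩, hw⟩

theorem finiteGlobalModelProperty {C : FrameClass.{u}}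
    (hC : C ∈ ({K4.{u}, D4.{u}, S4.{u}} : Set FrameClass.{u})) : FiniteGlobalModelProperty C := by
  intro φ h
  obtain ⟨M, hM, hfin, -, hw⟩ := h.exists_bounded hC
  exact ⟨M, ⟨hM, hfin⟩, hw⟩

end GradedModal

theorem mainTheorem1 :
    ∀ C ∈ ({GradedModal.K4.{u}, GradedModal.D4.{u}, GradedModal.S4.{u}} :
        Set GradedModal.FrameClass.{u}),
      GradedModal.FiniteLocalModelProperty C ∧
      GradedModal.FiniteGlobalModelProperty C ∧
      ComputablePred (fun φ : GradedModal.Formula => GradedModal.LocallySatisfiable C φ) ∧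
      ComputablePred (fun φ : GradedModal.Formula => GradedModal.GloballySatisfiable C φ) :=
  fun _ hC => ⟨GradedModal.finiteLocalModelProperty hC, GradedModal.finiteGlobalModelProperty hC,
    GradedModal.computablePred_locallySatisfiable hC,
    GradedModal.computablePred_globallySatisfiable hC⟩
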